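/- All rings are associative and unital. For a left module $M$ over a ring $R$ and submodules $N,L\subseteq M$ put $N*L=\sum\{f(N) : f\in \mathrm{Hom}_R(M,L)\}$. A nonzero module $M$ is called $*$-prime if $N*L\neq 0$ for all nonzero submodules $N,L$ of $M$. A ring $S\ne 0$ is prime if $aSb=0$ implies $a=0$ or $b=0$, for all $a,b\in S$. The left Krull dimension of $R$ is the deviation of its lattice of left ideals (Gabriel–Rentschler); thus it is at most $0$ if and only if $R$ is left artinian, and at most $1$ if and only if in every descending chain $I_0\supseteq I_1\supseteq\cdots$ of left ideals all but finitely many of the factors $I_i/I_{i+1}$ are artinian (in particular, it is at most $1$ if $R/I$ is artinian for every left ideal $I\neq 0$). **Proposition.** Let $R$ be a ring of left Krull dimension at most $1$ and let $M$ be a $*$-prime left $R$-module. Then the endomorphism ring $\mathrm{End}_R(M)$ is a prime ring. In particular, for every field $k$ of characteristic $0$, every $*$-prime left module over the first Weyl algebra $A_1(k)=k\langle x,y\rangle/(yx-xy-1)$ has a prime endomorphism ring. -/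

import Mathlib

universe u v

namespace StarPrime

/-- The product `N * L = N Hom_R(M, L) = ∑ {(N)f | f : M → L}` of two submodules of `M`. -/
def starProd {R : Type u} {M : Type v} [Ring R] [AddCommGroup M] [Module R M]
    (N L : Submodule R M) : Submodule R M :=
  ⨆ f : M →ₗ[R] L, N.map (L.subtype ∘ₗ f)

/-- The zero submodule is a prime element of the lattice of submodules of `M` with respect
to the product `starProd`. -/
def IsStarPrime (R : Type u) (M : Type v) [Ring R] [AddCommGroup M] [Module R M] : Prop :=
  ∀ N L : Submodule R M, starProd N L = ⊥ → N = ⊥ ∨ L = ⊥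

/-- A (not necessarily commutative) prime ring: it is nonzero, and `a S b = 0` implies `a = 0`
or `b = 0`. The condition is invariant under passing to the opposite ring, so it does not matter
on which side endomorphisms are written. -/
def IsPrimeRing (S : Type u) [Ring S] : Prop :=
  Nontrivial S ∧ ∀ a b : S, (∀ s : S, a * s * b = 0) → a = 0 ∨ b = 0

/-- `DeviationLE n a b`: the interval `[a, b]` of the poset `P` has deviation at most `n`.
Deviation at most `0` is the descending chain condition; deviation at most `n + 1` says that in
every descending chain all but finitely many of the factors have deviation at most `n`. -/
def DeviationLE {P : Type u} [PartialOrder P] : ℕ → P → P → Prop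
  | 0, a, b => ∀ s : ℕ → P, Antitone s → (∀ i, a ≤ s i ∧ s i ≤ b) →
      ∃ N, ∀ i ≥ N, s (i + 1) = s i
  | n + 1, a, b => ∀ s : ℕ → P, Antitone s → (∀ i, a ≤ s i ∧ s i ≤ b) →
      ∃ N, ∀ i ≥ N, DeviationLE n (s (i + 1)) (s i)

/-- The left Krull dimension (in the sense of Gabriel and Rentschler) of `R` is at most `n`:
the lattice of left ideals of `R` has deviation at most `n`. -/
def LeftKrullDimLE (R : Type u) [Ring R] (n : ℕ) : Prop :=
  DeviationLE n (⊥ : Submodule R R) ⊤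

/-- Left Krull dimension at most `0` means left artinian. -/
theorem leftKrullDimLE_zero_iff (R : Type u) [Ring R] :
    LeftKrullDimLE R 0 ↔ IsArtinian R R := by
  rw [← monotone_stabilizes_iff_artinian]
  constructor
  · intro h f
    obtain ⟨N, hN⟩ := h (fun i => OrderDual.ofDual (f i)) (fun i j hij => f.monotone hij)
      (fun i => ⟨bot_le, le_top⟩)
    refine ⟨N, fun m hm => ?_⟩
    induction m, hm using Nat.le_induction with
    | base => rfl
    | succ m hm ih => exact ih.trans (hN m hm).symm
  · intro h s hs _
    obtain ⟨N, hN⟩ := h ⟨fun i => OrderDual.toDual (s i), fun i j hij => hs hij⟩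
    exact ⟨N, fun i hi => (hN (i + 1) (by omega)).symm.trans (hN i hi)⟩

/-- If all the cyclic left modules `R ⧸ I` with `I ≠ 0` are artinian, then `R` has left Krull
dimension at most `1`. -/
theorem leftKrullDimLE_one_of_isArtinian_quotient (R : Type u) [Ring R]
    (h : ∀ I : Submodule R R, I ≠ ⊥ → IsArtinian R (R ⧸ I)) : LeftKrullDimLE R 1 := by
  intro s hs _
  by_cases hz : ∃ N, s N = ⊥
  · obtain ⟨N, hN⟩ := hz
    refine ⟨N, fun i hi t _ ht => ⟨0, fun j _ => ?_⟩⟩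
    have hb : s i = ⊥ := le_bot_iff.mp (hN ▸ hs hi)
    have hj (j : ℕ) : t j = ⊥ := le_bot_iff.mp (hb ▸ (ht j).2)
    rw [hj, hj]
  · push Not at hz
    refine ⟨0, fun i _ t hta ht => ?_⟩
    have := h _ (hz (i + 1))
    obtain ⟨N, hN⟩ := monotone_stabilizes_iff_artinian.mpr this
      ⟨fun j => OrderDual.toDual ((t j).map (s (i + 1)).mkQ),
        fun j k hjk => Submodule.map_mono (hta hjk)⟩
    have key (j : ℕ) : ((t j).map (s (i + 1)).mkQ).comap (s (i + 1)).mkQ = t j := by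
      rw [Submodule.comap_map_mkQ, sup_eq_right.mpr (ht j).1]
    have hN' (m : ℕ) (hm : N ≤ m) :
        (t N).map (s (i + 1)).mkQ = (t m).map (s (i + 1)).mkQ := hN m hm
    refine ⟨N, fun j hj => ?_⟩
    rw [← key (j + 1), ← key j, ← hN' (j + 1) (by omega), ← hN' j hj]

/-- The defining relation `y x = x y + 1` of the first Weyl algebra, where `x` and `y` are the
free generators with index `0` and `1`. -/
inductive WeylRel (k : Type u) [Field k] : FreeAlgebra k (Fin 2) → FreeAlgebra k (Fin 2) → Prop
  | comm : WeylRel k (FreeAlgebra.ι k 1 * FreeAlgebra.ι k 0)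
      (FreeAlgebra.ι k 0 * FreeAlgebra.ι k 1 + 1)

/-- The first Weyl algebra `A₁(k) = k⟨x, y⟩ / (y x - x y - 1)`. -/
abbrev WeylAlgebra (k : Type u) [Field k] : Type u := RingQuot (WeylRel k)

end StarPrime

/-! Suppose `a S b = 0` with `b ≠ 0`, where `S` is the endomorphism ring, and let `T =
endAnnihilator a`. It is fully invariant, killed by `a`, and nonzero because it contains the image
of `b`; by `*`-primeness it is essential. It remains to show that `a` kills every cyclic submodule
`C`, which has deviation at most one.

If `M` has a simple submodule `U`, every nonzero `K ≤ C` contains a copy of `U` inside `T` that some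
endomorphism with values in `U` splits off from `K`. Repeating this must stop, since an infinite
direct sum has deviation above one; so `C ≤ T` (`IsStarPrime.le_endAnnihilator_of_isAtom`).
Otherwise `M` has no nonzero artinian submodule. Maps from `M` to a critical submodule cut `C` down
to zero in finitely many steps, and `a` turns each step into an artinian factor; so `a C` is
artinian, hence zero (`IsStarPrime.deviationLE_zero_map`).

For the Weyl algebra, dimensions are counted along a weight filtration. A quotient by a nonzero left
ideal grows at most linearly (`finrank_weightLT_le`), while each nonzero factor of a chain grows at
least linearly with a fixed slope (`finrank_inf_add_lt`). This bounds the length of chains of left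
ideals above the given one. -/

namespace StarPrime

/-! ### Modules of deviation at most one -/

section Deviation

variable {R : Type u} {M : Type v} [Ring R] [AddCommGroup M] [Module R M]

/-- Extensions of artinian modules are artinian. -/
theorem DeviationLE.zero_trans {P : Type u} [Lattice P] [IsModularLattice P] {a b c : P}
    (hab : DeviationLE 0 a b) (hbc : DeviationLE 0 b c) (h₁ : a ≤ b) (h₂ : b ≤ c) :
    DeviationLE 0 a c := by
  intro s hs hac
  obtain ⟨N₁, hN₁⟩ := hab (fun i => s i ⊓ b) (fun i j hij => inf_le_inf_right b (hs hij))
    fun i => ⟨le_inf (hac i).1 h₁, inf_le_right⟩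
  obtain ⟨N₂, hN₂⟩ := hbc (fun i => s i ⊔ b) (fun i j hij => sup_le_sup_right (hs hij) b)
    fun i => ⟨le_sup_right, sup_le (hac i).2 h₂⟩
  refine ⟨max N₁ N₂, fun i hi => ?_⟩
  exact eq_of_le_of_inf_le_of_sup_le (hs i.le_succ)
    (hN₁ i (le_of_max_le_left hi)).ge (hN₂ i (le_of_max_le_right hi)).ge

/-- Cyclic modules have deviation at most the left Krull dimension of the ring (which is at most
one here). -/
theorem LeftKrullDimLE.deviationLE_span_singleton (hR : LeftKrullDimLE R 1) (m : M) :
    DeviationLE 1 (⊥ : Submodule R M) (Submodule.span R {m}) := by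
  set φ : R →ₗ[R] M := LinearMap.toSpanSingleton R M m with hφ
  have hr : LinearMap.range φ = Submodule.span R {m} := LinearMap.range_toSpanSingleton m
  have key (t : Submodule R M) (ht : t ≤ Submodule.span R {m}) : (t.comap φ).map φ = t :=
    Submodule.map_comap_eq_of_le (hr ▸ ht)
  intro s hs hsb
  obtain ⟨N, hN⟩ := hR (fun i => (s i).comap φ) (fun i j hij => Submodule.comap_mono (hs hij))
    fun i => ⟨bot_le, le_top⟩
  refine ⟨N, fun i hi t ht htb => ?_⟩
  obtain ⟨N', hN'⟩ := hN i hi (fun j => (t j).comap φ)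
    (fun j k hjk => Submodule.comap_mono (ht hjk))
    fun j => ⟨Submodule.comap_mono (htb j).1, Submodule.comap_mono (htb j).2⟩
  refine ⟨N', fun j hj => ?_⟩
  have hle (j : ℕ) : t j ≤ Submodule.span R {m} := (htb j).2.trans (hsb i).2
  rw [← key _ (hle (j + 1)), ← key _ (hle j), hN' j hj]

/-- A sequence of independent nonzero submodules does not fit into a module of deviation at most
one. -/
theorem not_deviationLE_one_of_iSupIndep {L : ℕ → Submodule R M} (hL : iSupIndep L)
    (h0 : ∀ n, L n ≠ ⊥) {C : Submodule R M} (hC : ∀ n, L n ≤ C) : ¬ DeviationLE 1 ⊥ C := by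
  intro h
  let D (s : Set ℕ) : Submodule R M := ⨆ n ∈ s, L n
  have hmono {s t : Set ℕ} (hst : s ⊆ t) : D s ≤ D t := biSup_mono hst
  -- The pairing function splits the summands into infinitely many infinite blocks. `A` discards
  -- whole blocks; `B` refines one step of that chain by discarding the summands of block `N` one at
  -- a time.
  let A (j : ℕ) : Set ℕ := {n | j ≤ n.unpair.1}
  obtain ⟨N, hN⟩ := h (fun j => D (A j)) (fun i j hij => hmono fun n hn => hij.trans hn)
    fun j => ⟨bot_le, iSup₂_le fun n _ => hC n⟩
  let B (k : ℕ) : Set ℕ := A (N + 1) ∪ {n | n.unpair.1 = N ∧ k ≤ n.unpair.2}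
  obtain ⟨K, hK⟩ := hN N le_rfl (fun k => D (B k))
    (fun i j hij => hmono <| Set.union_subset_union_right _ fun n hn => ⟨hn.1, hij.trans hn.2⟩)
    fun k => ⟨hmono Set.subset_union_left, hmono <| Set.union_subset
      (fun n hn => N.le_succ.trans hn) fun n hn => hn.1.ge⟩
  have hle : L (Nat.pair N K) ≤ D (B K) :=
    le_biSup L (Or.inr (by simp) : Nat.pair N K ∈ B K)
  have hd : Disjoint (L (Nat.pair N K)) (D (B (K + 1))) := by
    refine hL.disjoint_biSup ?_
    simp [B, A]
  have hle' := hle.trans (hK K le_rfl).ge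
  exact h0 _ (disjoint_self.mp (hd.mono_right hle'))

/-- In a vanishing sum, once the earlier terms are known to be zero, the `i`-th term equals minus a
sum of later ones, which lies in `K (i + 1)`. -/
theorem iSupIndep_of_disjoint_antitone {L K : ℕ → Submodule R M} (hK : Antitone K)
    (hLK : ∀ n, L n ≤ K n) (hd : ∀ n, Disjoint (L n) (K (n + 1))) : iSupIndep L := by
  rw [iSupIndep_iff_finsetSum_eq_zero_imp_eq_zero]
  intro s w hw hsum i
  induction i using Nat.strong_induction_on with
  | _ i ih =>
    intro hi
    have hmem : ∑ j ∈ s.erase i, w j ∈ K (i + 1) := by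
      refine Submodule.sum_mem _ fun j hj => ?_
      rw [Finset.mem_erase] at hj
      rcases lt_or_gt_of_ne hj.1 with h | h
      · rw [ih j h hj.2]
        exact zero_mem _
      · exact hK h (hLK j (hw j hj.2))
    rw [← Finset.add_sum_erase s w hi] at hsum
    refine Submodule.disjoint_def.mp (hd i) _ (hw i hi) ?_
    rw [eq_neg_of_add_eq_zero_left hsum]
    exact neg_mem hmem

/-- Used in contrapositive form: without simple submodules there are no nonzero artinian ones. -/
theorem exists_isAtom_of_deviationLE_zero {N : Submodule R M} (hN : N ≠ ⊥)
    (h : DeviationLE 0 ⊥ N) : ∃ U : Submodule R M, IsAtom U := by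
  by_contra! hU
  have hlt (X : {X : Submodule R M // X ≠ ⊥}) : ∃ Y : {X : Submodule R M // X ≠ ⊥}, Y < X := by
    by_contra! hY
    refine hU X ⟨X.2, fun Z hZ => ?_⟩
    by_contra hZ0
    exact hY ⟨Z, hZ0⟩ hZ
  choose g hg using hlt
  let s (n : ℕ) := g^[n] ⟨N, hN⟩
  have hs : StrictAnti s := strictAnti_nat_of_succ_lt fun n => by
    simpa only [s, Function.iterate_succ_apply'] using hg _
  obtain ⟨n, hn⟩ := h (fun n => (s n : Submodule R M)) (fun i j hij => hs.antitone hij)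
    fun n => ⟨bot_le, hs.antitone n.zero_le⟩
  exact (hs n.lt_succ_self).ne (Subtype.ext (hn n le_rfl))

/-- Every nonzero module of deviation at most one contains a nonzero submodule all of whose proper
quotients are artinian. -/
theorem exists_critical_of_deviationLE_one {C : Submodule R M} (hC : C ≠ ⊥)
    (h : DeviationLE 1 ⊥ C) :
    ∃ U : Submodule R M, U ≠ ⊥ ∧ ∀ V ≤ U, V ≠ ⊥ → DeviationLE 0 V U := by
  by_contra! hU
  have hlt (X : {X : Submodule R M // X ≠ ⊥}) : ∃ Y : {X : Submodule R M // X ≠ ⊥}, Y ≤ X ∧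
      ¬ DeviationLE 0 (Y : Submodule R M) X := by
    obtain ⟨V, hV, hV0, hd⟩ := hU X X.2
    exact ⟨⟨V, hV0⟩, hV, hd⟩
  choose g hg hg' using hlt
  let s (n : ℕ) := g^[n] ⟨C, hC⟩
  have hs : Antitone s := antitone_nat_of_succ_le fun n => by
    simpa only [s, Function.iterate_succ_apply'] using hg _
  obtain ⟨n, hn⟩ := h (fun n => (s n : Submodule R M)) (fun i j hij => hs hij)
    fun n => ⟨bot_le, hs n.zero_le⟩
  refine hg' (s n) ?_
  simpa only [s, Function.iterate_succ_apply'] using hn n le_rfl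

theorem map_inf_comap_eq (f : M →ₗ[R] M) (K t : Submodule R M) :
    (K ⊓ t.comap f).map f = K.map f ⊓ t := by
  apply SetLike.coe_injective
  simpa using Set.image_inter_preimage f K t

/-- An image of `K` under `f` is artinian if `K / (K ∩ ker f)` is. -/
theorem DeviationLE.zero_map {K : Submodule R M} (f : M →ₗ[R] M)
    (h : DeviationLE 0 (K ⊓ LinearMap.ker f) K) : DeviationLE 0 ⊥ (K.map f) := by
  intro t ht htb
  have key (i : ℕ) : (K ⊓ (t i).comap f).map f = t i := by
    rw [map_inf_comap_eq, inf_eq_right.mpr (htb i).2]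
  obtain ⟨N, hN⟩ := h (fun i => K ⊓ (t i).comap f)
    (fun i j hij => inf_le_inf_left _ (Submodule.comap_mono (ht hij)))
    fun i => ⟨inf_le_inf_left _ (LinearMap.ker_le_comap f), inf_le_left⟩
  refine ⟨N, fun i hi => ?_⟩
  rw [← key i, ← key (i + 1), hN i hi]

/-- If `a` vanishes on `T`, then `a K / a (K ∩ ker f)` is a subquotient of `U / f (K ∩ T)` for
every `f` with values in `U`. -/
theorem DeviationLE.zero_map_of_le_ker {K T U : Submodule R M} {a f : M →ₗ[R] M}
    (hf : LinearMap.range f ≤ U) (haT : T ≤ LinearMap.ker a)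
    (h : DeviationLE 0 ((K ⊓ T).map f) U) :
    DeviationLE 0 ((K ⊓ LinearMap.ker f).map a) (K.map a) := by
  intro t ht htb
  have key (i : ℕ) : (K ⊓ (t i).comap a).map a = t i := by
    rw [map_inf_comap_eq, inf_eq_right.mpr (htb i).2]
  obtain ⟨N, hN⟩ := h (fun i => (K ⊓ (t i).comap a).map f)
    (fun i j hij => Submodule.map_mono (inf_le_inf_left _ (Submodule.comap_mono (ht hij))))
    fun i => ⟨Submodule.map_mono (inf_le_inf_left _ (haT.trans (LinearMap.ker_le_comap a))),
      (LinearMap.map_le_range).trans hf⟩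
  refine ⟨N, fun i hi => le_antisymm (ht i.le_succ) ?_⟩
  rw [← key i, Submodule.map_le_iff_le_comap]
  intro x hx
  have hfx : f x ∈ (K ⊓ (t (i + 1)).comap a).map f := by
    rw [hN i hi]
    exact Submodule.mem_map_of_mem hx
  obtain ⟨y, hy, hyx⟩ := hfx
  have hxy : a (x - y) ∈ t (i + 1) := by
    refine (htb (i + 1)).1 (Submodule.mem_map_of_mem ⟨sub_mem hx.1 hy.1, ?_⟩)
    rw [SetLike.mem_coe, LinearMap.mem_ker, map_sub, hyx, sub_self]
  have hay : a y ∈ t (i + 1) := hy.2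
  rw [Submodule.mem_comap]
  simpa using add_mem hxy hay

end Deviation

/-! ### Primeness of the endomorphism ring -/

section Prime

variable {R : Type u} {M : Type v} [Ring R] [AddCommGroup M] [Module R M]

theorem IsStarPrime.exists_map_ne_bot (hM : IsStarPrime R M) {N L : Submodule R M}
    (hN : N ≠ ⊥) (hL : L ≠ ⊥) :
    ∃ f : M →ₗ[R] M, LinearMap.range f ≤ L ∧ N.map f ≠ ⊥ := by
  by_contra! h
  have : starProd N L = ⊥ := by
    refine iSup_eq_bot.mpr fun f => h _ ?_
    rintro _ ⟨x, rfl⟩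
    exact (f x).2
  exact (hM N L this).elim hN hL

/-- The submodule of all `x` such that `a` vanishes on all images of `x` under endomorphisms. -/
def endAnnihilator (a : Module.End R M) : Submodule R M :=
  ⨅ s : Module.End R M, LinearMap.ker (a * s)

theorem mem_endAnnihilator {a : Module.End R M} {x : M} :
    x ∈ endAnnihilator a ↔ ∀ s : Module.End R M, a (s x) = 0 := by
  simp [endAnnihilator]

theorem endAnnihilator_le_ker (a : Module.End R M) : endAnnihilator a ≤ LinearMap.ker a :=
  fun _ hx => mem_endAnnihilator.mp hx 1

/-- A nonzero `endAnnihilator` is essential. -/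
theorem IsStarPrime.inf_endAnnihilator_ne_bot (hM : IsStarPrime R M) {a : Module.End R M}
    (ha : endAnnihilator a ≠ ⊥) {N : Submodule R M} (hN : N ≠ ⊥) :
    N ⊓ endAnnihilator a ≠ ⊥ := by
  obtain ⟨f, hf, hf'⟩ := hM.exists_map_ne_bot ha hN
  refine ne_bot_of_le_ne_bot hf' (le_inf (LinearMap.map_le_range.trans hf) ?_)
  rintro _ ⟨x, hx, rfl⟩
  rw [SetLike.mem_coe, mem_endAnnihilator] at hx
  exact mem_endAnnihilator.mpr fun s => hx (s * f)

/-- If `M` has a simple submodule, then submodules of deviation at most one lie in every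
fully invariant submodule of the form `endAnnihilator a`. -/
theorem IsStarPrime.le_endAnnihilator_of_isAtom (hM : IsStarPrime R M) {a : Module.End R M}
    (ha : endAnnihilator a ≠ ⊥) {U C : Submodule R M} (hU : IsAtom U)
    (hC : DeviationLE 1 ⊥ C) : C ≤ endAnnihilator a := by
  set T := endAnnihilator a
  -- The hypothesis `K ≠ ⊥` sits inside the existential so that `choose` gives total functions,
  -- which can be iterated.
  have step (K : Submodule R M) : ∃ (L : Submodule R M) (f : M →ₗ[R] M), K ≠ ⊥ →
      L ≠ ⊥ ∧ L ≤ K ⊓ T ∧ Disjoint L (LinearMap.ker f) ∧ K ≤ L ⊔ K ⊓ LinearMap.ker f := by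
    by_cases hK : K = ⊥
    · exact ⟨⊥, 0, fun h => (h hK).elim⟩
    -- `h` places a copy of `U` in `K ⊓ T`, and `f` carries this copy back onto `U`; simplicity
    -- makes both maps injective on it, so it is a direct summand of `K`.
    obtain ⟨h, hh, hh'⟩ := hM.exists_map_ne_bot hU.1 (hM.inf_endAnnihilator_ne_bot ha hK)
    obtain ⟨f, hf, hf'⟩ := hM.exists_map_ne_bot hh' hU.1
    have hfU : (U.map h).map f = U :=
      (hU.le_iff.mp (LinearMap.map_le_range.trans hf)).resolve_left hf'
    refine ⟨U.map h, f, fun _ => ⟨hh', LinearMap.map_le_range.trans hh, ?_, fun x hx => ?_⟩⟩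
    · rw [Submodule.disjoint_def]
      rintro _ ⟨u, hu, rfl⟩ hu'
      rcases hU.le_iff.mp (inf_le_left : U ⊓ LinearMap.ker (f ∘ₗ h) ≤ U) with h0 | h0
      · have : u ∈ U ⊓ LinearMap.ker (f ∘ₗ h) := ⟨hu, hu'⟩
        rw [h0, Submodule.mem_bot] at this
        rw [this, map_zero]
      · refine (hf' ?_).elim
        rw [← Submodule.map_comp, ← LinearMap.le_ker_iff_map]
        exact inf_eq_left.mp h0
    · have hfx : f x ∈ (U.map h).map f := hfU.ge (hf ⟨x, rfl⟩)
      obtain ⟨y, hy, hyx⟩ := hfx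
      have hyK : y ∈ K := (LinearMap.map_le_range.trans hh hy).1
      refine Submodule.mem_sup.mpr ⟨y, hy, x - y, ⟨sub_mem hx hyK, ?_⟩, by abel⟩
      rw [SetLike.mem_coe, LinearMap.mem_ker, map_sub, hyx, sub_self]
  choose L f hLf using step
  let K (n : ℕ) : Submodule R M := (fun X => X ⊓ LinearMap.ker (f X))^[n] C
  have hKs (n : ℕ) : K (n + 1) = K n ⊓ LinearMap.ker (f (K n)) :=
    Function.iterate_succ_apply' _ _ _
  have hK : Antitone K := antitone_nat_of_succ_le fun n => (hKs n).trans_le inf_le_left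
  have hterm : ∃ n, K n = ⊥ := by
    by_contra! hne
    refine not_deviationLE_one_of_iSupIndep
      (iSupIndep_of_disjoint_antitone (L := fun n => L (K n)) hK
        (fun n => (hLf _ (hne n)).2.1.trans inf_le_left) fun n => ?_)
      (fun n => (hLf _ (hne n)).1)
      (fun n => ((hLf _ (hne n)).2.1.trans inf_le_left).trans (hK n.zero_le)) hC
    exact (hLf _ (hne n)).2.2.1.mono_right ((hKs n).trans_le inf_le_right)
  obtain ⟨n, hn⟩ := hterm
  have hle (j : ℕ) : C ≤ T ⊔ K j := by
    induction j with
    | zero => exact le_sup_right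
    | succ j ih =>
      by_cases hj : K j = ⊥
      · rw [hj] at ih
        exact ih.trans (sup_le_sup_left bot_le _)
      · obtain ⟨-, h₁, -, h₂⟩ := hLf _ hj
        rw [← hKs] at h₂
        exact ih.trans (sup_le le_sup_left
          (h₂.trans (sup_le_sup_right (h₁.trans inf_le_right) _)))
  simpa [hn] using hle n

/-- If `M` has no nonzero artinian submodule, then the image under `a` of a submodule of deviation
at most one is artinian. -/
theorem IsStarPrime.deviationLE_zero_map (hM : IsStarPrime R M) {a : Module.End R M}
    (ha : endAnnihilator a ≠ ⊥) (hart : ∀ N : Submodule R M, DeviationLE 0 ⊥ N → N = ⊥)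
    {C : Submodule R M} (hC : DeviationLE 1 ⊥ C) : DeviationLE 0 ⊥ (C.map a) := by
  by_cases hC0 : C = ⊥
  · subst hC0
    rw [Submodule.map_bot]
    exact fun t _ htb => ⟨0, fun i _ => by rw [le_bot_iff.mp (htb i).2, le_bot_iff.mp (htb _).2]⟩
  obtain ⟨U, hU, hUV⟩ := exists_critical_of_deviationLE_one hC0 hC
  set T := endAnnihilator a
  have step (K : Submodule R M) : ∃ f : M →ₗ[R] M, K ≠ ⊥ →
      LinearMap.range f ≤ U ∧ (K ⊓ T).map f ≠ ⊥ := by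
    by_cases hK : K = ⊥
    · exact ⟨0, fun h => (h hK).elim⟩
    obtain ⟨f, hf⟩ := hM.exists_map_ne_bot (hM.inf_endAnnihilator_ne_bot ha hK) hU
    exact ⟨f, fun _ => hf⟩
  choose f hf using step
  let K (n : ℕ) : Submodule R M := (fun X => X ⊓ LinearMap.ker (f X))^[n] C
  have hKs (n : ℕ) : K (n + 1) = K n ⊓ LinearMap.ker (f (K n)) :=
    Function.iterate_succ_apply' _ _ _
  have hK : Antitone K := antitone_nat_of_succ_le fun n => (hKs n).trans_le inf_le_left
  -- Each factor `K n / K (n + 1)` is isomorphic to a nonzero submodule of `M`, so it is not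
  -- artinian; deviation at most one allows only finitely many of these.
  have hterm : ∃ n, K n = ⊥ := by
    by_contra! hne
    obtain ⟨n, hn⟩ := hC K hK fun n => ⟨bot_le, hK n.zero_le⟩
    have h0 := hn n le_rfl
    rw [hKs] at h0
    exact (hf _ (hne n)).2 (le_bot_iff.mp
      ((Submodule.map_mono inf_le_left).trans (hart _ h0.zero_map).le))
  obtain ⟨n, hn⟩ := hterm
  have hle (j : ℕ) : DeviationLE 0 ((K j).map a) (C.map a) := by
    induction j with
    | zero => exact fun t _ htb => ⟨0, fun i _ =>
        (le_antisymm (htb _).2 (htb _).1).trans (le_antisymm (htb _).1 (htb _).2)⟩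
    | succ j ih =>
      by_cases hj : K j = ⊥
      · rwa [hKs, hj, bot_inf_eq, ← hj]
      · obtain ⟨h₁, h₂⟩ := hf _ hj
        have := DeviationLE.zero_map_of_le_ker h₁ (endAnnihilator_le_ker a)
          (hUV _ (LinearMap.map_le_range.trans h₁) h₂)
        rw [← hKs] at this
        exact this.zero_trans ih (Submodule.map_mono (hK j.le_succ))
          (Submodule.map_mono (hK j.zero_le))
  simpa [hn] using hle n

/-- Star-prime modules over rings of left Krull dimension at most one have prime endomorphism
rings. -/
theorem IsStarPrime.isPrimeRing_end [Nontrivial M] (hR : LeftKrullDimLE R 1)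
    (hM : IsStarPrime R M) : IsPrimeRing (Module.End R M) := by
  refine ⟨inferInstance, fun a b hab => ?_⟩
  by_contra! hne
  obtain ⟨ha, hb⟩ := hne
  -- The image of `b` lies in `endAnnihilator a`.
  have hT : endAnnihilator a ≠ ⊥ := by
    intro h
    refine hb (LinearMap.ext fun x => ?_)
    have : b x ∈ endAnnihilator a :=
      mem_endAnnihilator.mpr fun s => LinearMap.congr_fun (hab s) x
    rwa [h, Submodule.mem_bot] at this
  refine ha (LinearMap.ext fun m => ?_)
  have hC := hR.deviationLE_span_singleton m
  have hm := Submodule.mem_span_singleton_self (R := R) m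
  by_cases hU : ∃ U : Submodule R M, IsAtom U
  · obtain ⟨U, hU⟩ := hU
    exact endAnnihilator_le_ker a (hM.le_endAnnihilator_of_isAtom hT hU hC hm)
  · have hart (N : Submodule R M) (h : DeviationLE 0 ⊥ N) : N = ⊥ := by
      by_contra hN
      exact hU (exists_isAtom_of_deviationLE_zero hN h)
    have := hart _ (hM.deviationLE_zero_map hT hart hC)
    exact (LinearMap.le_ker_iff_map.mpr this) hm

end Prime

/-! ### Growth of modules over the Weyl algebra -/

section Weyl

variable {k : Type u} {A : Type v} [Field k] [Ring A] [Algebra k A]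

/-- The span of the monomials `x ^ i * y ^ j` of weight `i + W * j` less than `n`. -/
def weightLT (k : Type u) {A : Type v} [Field k] [Ring A] [Algebra k A] (x y : A) (W n : ℕ) :
    Submodule k A :=
  Submodule.span k ((fun p : ℕ × ℕ => x ^ p.1 * y ^ p.2) '' {p | p.1 + W * p.2 < n})

variable {x y : A} {W : ℕ}

theorem monomial_mem_weightLT {i j n : ℕ} (h : i + W * j < n) :
    x ^ i * y ^ j ∈ weightLT k x y W n :=
  Submodule.subset_span ⟨(i, j), h, rfl⟩

theorem weightLT_mono : Monotone (weightLT k x y W) := fun _ _ hmn =>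
  Submodule.span_mono (Set.image_mono fun _ hp => lt_of_lt_of_le hp hmn)

theorem weightLT_le_iff {n : ℕ} {S : Submodule k A} :
    weightLT k x y W n ≤ S ↔ ∀ i j, i + W * j < n → x ^ i * y ^ j ∈ S := by
  rw [weightLT, Submodule.span_le, Set.image_subset_iff]
  exact ⟨fun h i j hij => h (a := (i, j)) hij, fun h p hp => h p.1 p.2 hp⟩

theorem weight_finite (hW : 0 < W) (n : ℕ) : {p : ℕ × ℕ | p.1 + W * p.2 < n}.Finite := by
  refine (Set.finite_Iio n |>.prod (Set.finite_Iio n)).subset fun p hp => ?_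
  have hp' : p.1 + W * p.2 < n := hp
  have := Nat.le_mul_of_pos_left p.2 hW
  exact ⟨by simp; omega, by simp; omega⟩

theorem finiteDimensional_weightLT (hW : 0 < W) (n : ℕ) :
    FiniteDimensional k (weightLT k x y W n) :=
  FiniteDimensional.span_of_finite k ((weight_finite hW n).image _)

theorem x_mul_mem_weightLT {n : ℕ} {g : A} (hg : g ∈ weightLT k x y W n) :
    x * g ∈ weightLT k x y W (n + 1) := by
  have : weightLT k x y W n ≤ (weightLT k x y W (n + 1)).comap (LinearMap.mulLeft k x) := by
    refine weightLT_le_iff.mpr fun i j h => ?_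
    rw [Submodule.mem_comap, LinearMap.mulLeft_apply, ← mul_assoc, ← pow_succ']
    exact monomial_mem_weightLT (by omega)
  exact this hg

theorem y_mul_x_pow (hxy : y * x = x * y + 1) (i : ℕ) :
    y * x ^ (i + 1) = x ^ (i + 1) * y + (i + 1 : ℕ) • x ^ i := by
  induction i with
  | zero => simp [hxy]
  | succ i ih =>
    rw [pow_succ x (i + 1), ← mul_assoc, ih, add_mul, mul_assoc, hxy, mul_add, mul_one,
      smul_mul_assoc, ← pow_succ, succ_nsmul (x ^ (i + 1)) (i + 1), mul_assoc]
    abel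

/-- The error is a multiple of the monomial with one `x` and one `y` removed, so its weight drops by
`W + 1`. -/
theorem y_mul_monomial_sub_mem (hxy : y * x = x * y + 1) (hW : 0 < W) (i j : ℕ) :
    y * (x ^ i * y ^ j) - x ^ i * y ^ (j + 1) ∈ weightLT k x y W (i + W * (j + 1)) := by
  cases i with
  | zero => simp [pow_succ']
  | succ i =>
    rw [← mul_assoc, y_mul_x_pow hxy, add_mul, mul_assoc, ← pow_succ', add_sub_cancel_left,
      smul_mul_assoc]
    exact nsmul_mem (monomial_mem_weightLT (by rw [Nat.mul_succ]; omega)) _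

theorem y_mul_mem_weightLT (hxy : y * x = x * y + 1) (hW : 0 < W) {n : ℕ} {g : A}
    (hg : g ∈ weightLT k x y W n) : y * g ∈ weightLT k x y W (n + W) := by
  have : weightLT k x y W n ≤ (weightLT k x y W (n + W)).comap (LinearMap.mulLeft k y) := by
    refine weightLT_le_iff.mpr fun i j h => ?_
    rw [Submodule.mem_comap, LinearMap.mulLeft_apply,
      ← sub_add_cancel (y * (x ^ i * y ^ j)) (x ^ i * y ^ (j + 1))]
    exact add_mem (weightLT_mono (by rw [Nat.mul_succ]; omega) (y_mul_monomial_sub_mem hxy hW i j))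
      (monomial_mem_weightLT (by rw [Nat.mul_succ]; omega))
  exact this hg

theorem x_pow_mul_mem_weightLT {n : ℕ} {g : A} (hg : g ∈ weightLT k x y W n) (i : ℕ) :
    x ^ i * g ∈ weightLT k x y W (n + i) := by
  induction i with
  | zero => simpa using hg
  | succ i ih =>
    rw [pow_succ', mul_assoc]
    exact x_mul_mem_weightLT ih

theorem y_pow_mul_mem_weightLT (hxy : y * x = x * y + 1) (hW : 0 < W) {n : ℕ} {g : A}
    (hg : g ∈ weightLT k x y W n) (j : ℕ) : y ^ j * g ∈ weightLT k x y W (n + W * j) := by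
  induction j with
  | zero => simpa using hg
  | succ j ih =>
    rw [pow_succ', mul_assoc, Nat.mul_succ, ← add_assoc]
    exact y_mul_mem_weightLT hxy hW ih

theorem mul_mem_weightLT (hxy : y * x = x * y + 1) (hW : 0 < W) {m n : ℕ} {g h : A}
    (hg : g ∈ weightLT k x y W m) (hh : h ∈ weightLT k x y W n) :
    g * h ∈ weightLT k x y W (m + n) := by
  have : weightLT k x y W m ≤ (weightLT k x y W (m + n)).comap (LinearMap.mulRight k h) := by
    refine weightLT_le_iff.mpr fun i j hij => ?_
    rw [Submodule.mem_comap, LinearMap.mulRight_apply, mul_assoc]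
    exact weightLT_mono (by omega)
      (x_pow_mul_mem_weightLT (y_pow_mul_mem_weightLT hxy hW hh j) i)
  exact this hg

/-- Monomials multiply as in a commutative polynomial ring, up to terms of lower weight. -/
theorem monomial_mul_monomial_sub_mem (hxy : y * x = x * y + 1) (hW : 0 < W) (i j a b : ℕ) :
    x ^ i * y ^ j * (x ^ a * y ^ b) - x ^ (i + a) * y ^ (j + b) ∈
      weightLT k x y W (i + a + W * (j + b)) := by
  have key : y ^ j * (x ^ a * y ^ b) - x ^ a * y ^ (j + b) ∈
      weightLT k x y W (a + W * (j + b)) := by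
    induction j with
    | zero => simp
    | succ j ih =>
      have h₁ := y_mul_mem_weightLT hxy hW ih
      have h₂ := y_mul_monomial_sub_mem (k := k) hxy hW a (j + b)
      rw [add_assoc, ← Nat.mul_succ] at h₁
      have := add_mem h₁ h₂
      rw [mul_sub, sub_add_sub_cancel, ← mul_assoc, ← pow_succ'] at this
      rwa [Nat.succ_add]
  have := x_pow_mul_mem_weightLT key i
  rw [mul_sub, ← mul_assoc, ← mul_assoc (x ^ i), ← pow_add] at this
  exact weightLT_mono (by omega) this

/-- If the monomials span, every nonzero element has, for a suitable weight, a single monomial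
as its leading form. -/
theorem exists_leading_monomial (hspan : ∀ g : A, ∃ c : (ℕ × ℕ) →₀ k,
      g = c.sum fun p r => r • (x ^ p.1 * y ^ p.2)) {P : A} (hP : P ≠ 0) :
    ∃ (W a b : ℕ) (r : k), 0 < W ∧ r ≠ 0 ∧
      P - r • (x ^ a * y ^ b) ∈ weightLT k x y W (a + W * b) := by
  obtain ⟨c, rfl⟩ := hspan P
  have hc : c.support.Nonempty := by
    rw [Finsupp.support_nonempty_iff]
    rintro rfl
    simp at hP
  -- `W` exceeds every `x`-exponent in the support, so `i + W * j` is a base-`W` expansion with last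
  -- digit `i`: distinct monomials have distinct weights and the maximum is attained once.
  set W := c.support.sup Prod.fst + 1 with hW
  obtain ⟨p, hp, hmax⟩ := c.support.exists_max_image (fun p => p.1 + W * p.2) hc
  refine ⟨W, p.1, p.2, c p, by omega, Finsupp.mem_support_iff.mp hp, ?_⟩
  rw [Finsupp.sum, ← Finset.add_sum_erase _ _ hp, add_sub_cancel_left]
  refine Submodule.sum_mem _ fun q hq => Submodule.smul_mem _ _ (monomial_mem_weightLT ?_)
  rw [Finset.mem_erase] at hq
  refine lt_of_le_of_ne (hmax q hq.2) fun heq => hq.1 ?_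
  have h₁ : q.1 < W := Nat.lt_succ_of_le (Finset.le_sup (f := Prod.fst) hq.2)
  have h₂ : p.1 < W := Nat.lt_succ_of_le (Finset.le_sup (f := Prod.fst) hp)
  have h₃ : q.1 = p.1 := by
    simpa [Nat.mod_eq_of_lt h₁, Nat.mod_eq_of_lt h₂] using congrArg (· % W) heq
  refine Prod.ext h₃ (Nat.eq_of_mul_eq_mul_left (by omega : 0 < W) ?_)
  omega

/-- The dimensions of the filtered pieces of a proper quotient grow at most linearly. -/
theorem finrank_weightLT_le (hxy : y * x = x * y + 1) (hW : 0 < W) {J : Submodule A A} {P : A}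
    (hPJ : P ∈ J) {a b : ℕ} {r : k} (hr : r ≠ 0)
    (hP : P - r • (x ^ a * y ^ b) ∈ weightLT k x y W (a + W * b)) (n : ℕ) :
    Module.finrank k (weightLT k x y W n) ≤
      (a + b) * n + Module.finrank k (J.restrictScalars k ⊓ weightLT k x y W n : Submodule k A) := by
  classical
  have := finiteDimensional_weightLT (k := k) (x := x) (y := y) hW n
  -- The exponents not divisible by the leading monomial; the two strips contain at most `(a + b) *
  -- n` points.
  let F (n : ℕ) : Finset (ℕ × ℕ) :=
    (Finset.range a ×ˢ Finset.range n ∪ Finset.range n ×ˢ Finset.range b).filter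
      fun p => p.1 + W * p.2 < n
  let S (n : ℕ) : Submodule k A :=
    Submodule.span k ((F n).image fun p : ℕ × ℕ => x ^ p.1 * y ^ p.2 : Finset A)
  have hmem (i j n : ℕ) (h : i + W * j < n) (hij : i < a ∨ j < b) : x ^ i * y ^ j ∈ S n := by
    refine Submodule.subset_span (Finset.mem_coe.mpr (Finset.mem_image.mpr ⟨(i, j), ?_, rfl⟩))
    have := Nat.le_mul_of_pos_left j hW
    simp only [F, Finset.mem_filter, Finset.mem_union, Finset.mem_product, Finset.mem_range]
    omega
  have hSG (n : ℕ) : S n ≤ weightLT k x y W n := by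
    refine Submodule.span_le.mpr fun g hg => ?_
    obtain ⟨p, hp, rfl⟩ := Finset.mem_image.mp (Finset.mem_coe.mp hg)
    exact monomial_mem_weightLT (Finset.mem_filter.mp hp).2
  have hSmono (n : ℕ) : S n ≤ S (n + 1) := by
    refine Submodule.span_mono (Finset.coe_subset.mpr (Finset.image_subset_image fun p hp => ?_))
    simp only [F, Finset.mem_filter, Finset.mem_union, Finset.mem_product, Finset.mem_range] at hp ⊢
    omega
  have hred (n : ℕ) : weightLT k x y W n ≤ S n ⊔ J.restrictScalars k := by
    induction n with
    | zero => exact weightLT_le_iff.mpr fun i j h => absurd h (Nat.not_lt_zero _)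
    | succ n ih =>
      have ih' := ih.trans (sup_le_sup_right (hSmono n) _)
      refine weightLT_le_iff.mpr fun i j h => ?_
      by_cases hij : i < a ∨ j < b
      · exact Submodule.mem_sup_left (hmem i j _ h hij)
      rcases Nat.lt_succ_iff_lt_or_eq.mp h with h | h
      · exact ih' (monomial_mem_weightLT h)
      push Not at hij
      obtain ⟨⟨i, rfl⟩, ⟨j, rfl⟩⟩ := And.intro (Nat.exists_eq_add_of_le' hij.1)
        (Nat.exists_eq_add_of_le' hij.2)
      -- The multiple `x ^ i * y ^ j * P` of `P` lies in `J` and has leading term `r • (x ^ (i + a)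
      -- * y ^ (j + b))`, so modulo `J` this monomial reduces to lower weight.
      have h₁ := monomial_mul_monomial_sub_mem (k := k) hxy hW i j a b
      have h₂ := x_pow_mul_mem_weightLT (y_pow_mul_mem_weightLT hxy hW hP j) i
      rw [h] at h₁
      have h₂' : _ ∈ weightLT k x y W n := weightLT_mono (by rw [← h, Nat.mul_add]; omega) h₂
      have h₃ : x ^ i * y ^ j * P ∈ S (n + 1) ⊔ J.restrictScalars k :=
        Submodule.mem_sup_right (J.smul_mem (x ^ i * y ^ j) hPJ)
      have h₄ := sub_mem h₃ (ih' (add_mem h₂' (Submodule.smul_mem _ r h₁)))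
      have h₅ : x ^ i * y ^ j * P - (x ^ i * (y ^ j * (P - r • (x ^ a * y ^ b))) +
          r • (x ^ i * y ^ j * (x ^ a * y ^ b) - x ^ (i + a) * y ^ (j + b))) =
          r • (x ^ (i + a) * y ^ (j + b)) := by
        simp only [mul_sub, mul_smul_comm, smul_sub, mul_assoc]
        abel
      rw [h₅] at h₄
      exact (Submodule.smul_mem_iff _ hr).mp h₄
  have heq : weightLT k x y W n = S n ⊔ J.restrictScalars k ⊓ weightLT k x y W n := by
    rw [← sup_inf_assoc_of_le _ (hSG n), inf_eq_right.mpr (hred n)]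
  have hfS : FiniteDimensional k (S n) := Submodule.finiteDimensional_of_le (hSG n)
  have hfJ : FiniteDimensional k (J.restrictScalars k ⊓ weightLT k x y W n : Submodule k A) :=
    Submodule.finiteDimensional_of_le inf_le_right
  have hcard : Module.finrank k (S n) ≤ (a + b) * n := by
    refine (finrank_span_finset_le_card _).trans (Finset.card_image_le.trans
      ((Finset.card_filter_le _ _).trans ((Finset.card_union_le _ _).trans ?_)))
    simp only [Finset.card_product, Finset.card_range]
    exact le_of_eq (by ring)
  calc Module.finrank k (weightLT k x y W n)
      = Module.finrank k (S n ⊔ J.restrictScalars k ⊓ weightLT k x y W n : Submodule k A) := by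
        rw [← heq]
    _ ≤ _ := (Submodule.finrank_add_le_finrank_add_finrank _ _).trans (by omega)

/-- In characteristic zero, no nonzero finite-dimensional space is stable under operators
satisfying the Weyl relation. -/
theorem eq_bot_of_weyl_stable [CharZero k] (hxy : y * x = x * y + 1) {N : Type*} [AddCommGroup N]
    [Module k N] [Module A N] [IsScalarTower k A N] (H : Submodule k N) [FiniteDimensional k H]
    (hx : ∀ v ∈ H, x • v ∈ H) (hy : ∀ v ∈ H, y • v ∈ H) : H = ⊥ := by
  let X : Module.End k H := (Algebra.lsmul k k N x).restrict hx
  let Y : Module.End k H := (Algebra.lsmul k k N y).restrict hy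
  have hXY : Y * X = X * Y + 1 := by
    ext v
    change y • x • (v : N) = x • y • (v : N) + v
    rw [← mul_smul, hxy, add_smul, mul_smul, one_smul]
  have := congrArg (LinearMap.trace k H) hXY
  rw [map_add, LinearMap.trace_mul_comm k Y X, LinearMap.trace_one, left_eq_add,
    Nat.cast_eq_zero] at this
  exact Submodule.finrank_eq_zero.mp this

/-- The filtered pieces of a nonzero cyclic module grow at least linearly. -/
theorem lt_finrank_map_weightLT [CharZero k] (hxy : y * x = x * y + 1) (hW : 0 < W) {N : Type*}
    [AddCommGroup N] [Module k N] [Module A N] [IsScalarTower k A N] {v : N} (hv : v ≠ 0) (l : ℕ) :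
    l < Module.finrank k ((weightLT k x y W (W * l + 1)).map
      ((LinearMap.toSpanSingleton A N v).restrictScalars k)) := by
  set φ := (LinearMap.toSpanSingleton A N v).restrictScalars k
  set H : ℕ → Submodule k N := fun l => (weightLT k x y W (W * l + 1)).map φ
  have hmono (l : ℕ) : H l ≤ H (l + 1) :=
    Submodule.map_mono (weightLT_mono (by rw [Nat.mul_succ]; omega))
  have hvH (l : ℕ) : v ∈ H l := by
    have h1 : x ^ 0 * y ^ 0 ∈ weightLT k x y W (W * l + 1) := monomial_mem_weightLT (by omega)
    rw [pow_zero, pow_zero, one_mul] at h1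
    exact ⟨1, h1, by simp [φ]⟩
  have hfin (l : ℕ) : FiniteDimensional k (H l) := by
    have := finiteDimensional_weightLT (k := k) (x := x) (y := y) hW (W * l + 1)
    exact Module.Finite.map _ _
  have hne (l : ℕ) : H l ≠ ⊥ := fun h => hv (by simpa [h] using hvH l)
  change l < Module.finrank k (H l)
  induction l with
  | zero => exact Nat.pos_of_ne_zero fun h => hne 0 (Submodule.finrank_eq_zero.mp h)
  | succ l ih =>
    -- If `H` stopped growing, it would be stable under `x` and `y`, as one step adds `W` to the
    -- weight bound and neither generator raises weights by more.
    refine lt_of_le_of_lt (Nat.succ_le_of_lt ih) (Submodule.finrank_lt_finrank_of_lt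
      (lt_of_le_of_ne (hmono l) fun heq => hne l (eq_bot_of_weyl_stable hxy (H l) ?_ ?_)))
    · rintro _ ⟨g, hg, rfl⟩
      rw [heq]
      refine ⟨x * g, weightLT_mono ?_ (x_mul_mem_weightLT hg), by simp [φ, mul_smul]⟩
      rw [Nat.mul_succ]; omega
    · rintro _ ⟨g, hg, rfl⟩
      rw [heq]
      refine ⟨y * g, weightLT_mono ?_ (y_mul_mem_weightLT hxy hW hg), by simp [φ, mul_smul]⟩
      rw [Nat.mul_succ]; omega

/-- The class of `z` generates a nonzero cyclic submodule of `J / J'`. Multiplying `z` by elements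
of weight at most `W * l` stays inside weight below `n`, so this submodule already contributes more
than `l` dimensions. -/
theorem finrank_inf_add_lt [CharZero k] (hxy : y * x = x * y + 1) (hW : 0 < W)
    {J J' : Submodule A A} (hJ : J' ≤ J) {z : A} (hz : z ∈ J) (hz' : z ∉ J') {e n l : ℕ}
    (hze : z ∈ weightLT k x y W e) (hn : W * l + 1 + e ≤ n) :
    Module.finrank k (J'.restrictScalars k ⊓ weightLT k x y W n : Submodule k A) + l <
      Module.finrank k (J.restrictScalars k ⊓ weightLT k x y W n : Submodule k A) := by
  set G := weightLT k x y W n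
  have := finiteDimensional_weightLT (k := k) (x := x) (y := y) hW n
  have hfJ : FiniteDimensional k (J.restrictScalars k ⊓ G : Submodule k A) :=
    Submodule.finiteDimensional_of_le inf_le_right
  set B : Submodule k A := J.restrictScalars k ⊓ G
  let ψ : A →ₗ[k] A ⧸ J' := J'.mkQ.restrictScalars k
  have hv : J'.mkQ z ≠ 0 := by simpa using hz'
  have hlow := lt_finrank_map_weightLT (k := k) hxy hW hv l
  have hle : (weightLT k x y W (W * l + 1)).map
      ((LinearMap.toSpanSingleton A (A ⧸ J') (J'.mkQ z)).restrictScalars k) ≤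
      LinearMap.range (ψ.domRestrict B) := by
    rintro _ ⟨g, hg, rfl⟩
    exact ⟨⟨g * z, J.smul_mem g hz, weightLT_mono hn (mul_mem_weightLT hxy hW hg hze)⟩, rfl⟩
  have hker : (LinearMap.ker (ψ.domRestrict B)).map B.subtype = J'.restrictScalars k ⊓ G := by
    ext g
    simp only [Submodule.mem_map, LinearMap.mem_ker, Submodule.mem_inf,
      Submodule.restrictScalars_mem]
    constructor
    · rintro ⟨g, hg, rfl⟩
      exact ⟨(Submodule.Quotient.mk_eq_zero _).mp hg, g.2.2⟩
    · rintro ⟨h₁, h₂⟩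
      exact ⟨⟨g, hJ h₁, h₂⟩, (Submodule.Quotient.mk_eq_zero _).mpr h₁, rfl⟩
  have h₁ := LinearMap.finrank_range_add_finrank_ker (ψ.domRestrict B)
  have h₂ := Submodule.finrank_map_subtype_eq B (LinearMap.ker (ψ.domRestrict B))
  rw [hker] at h₂
  have h₃ := Submodule.finrank_mono hle
  omega

/-- Proper quotients of the first Weyl algebra in characteristic zero are artinian. -/
theorem isArtinian_quotient_of_weyl [CharZero k] (hxy : y * x = x * y + 1)
    (hspan : ∀ g : A, ∃ c : (ℕ × ℕ) →₀ k, g = c.sum fun p r => r • (x ^ p.1 * y ^ p.2))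
    {I : Submodule A A} (hI : I ≠ ⊥) : IsArtinian A (A ⧸ I) := by
  obtain ⟨P, hPI, hP0⟩ := (Submodule.ne_bot_iff I).mp hI
  obtain ⟨W, a, b, r, hW, hr, hP⟩ := exists_leading_monomial hspan hP0
  rw [isArtinian_iff, wellFounded_iff_isEmpty_descending_chain]
  refine ⟨fun ⟨s, hs⟩ => ?_⟩
  let J (n : ℕ) : Submodule A A := (s n).comap I.mkQ
  have hJ (n : ℕ) : J (n + 1) < J n :=
    Submodule.comap_strictMono_of_surjective I.mkQ_surjective (hs n)
  have hIJ (n : ℕ) : I ≤ J n := Submodule.le_comap_mkQ I (s n)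
  choose z hz hz' using fun n => SetLike.exists_of_lt (hJ n)
  have hex (g : A) : ∃ e, g ∈ weightLT k x y W e := by
    obtain ⟨c, rfl⟩ := hspan g
    refine ⟨c.support.sup (fun p => p.1 + W * p.2) + 1, Submodule.sum_mem _ fun p hp =>
      Submodule.smul_mem _ _ (monomial_mem_weightLT (Nat.lt_succ_of_le ?_))⟩
    exact Finset.le_sup (f := fun p : ℕ × ℕ => p.1 + W * p.2) hp
  choose e he using fun n => hex (z n)
  -- With `m` strict steps, each of growth slope `1 / W`, the total slope exceeds the upper bound `a
  -- + b`. `E` bounds the weights of the chosen generators, and `l` is just large enough to absorb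
  -- the constant terms: `(a + b) * n = (a + b) * W * l + l < m * (l + 1)`.
  set m := (a + b) * W + 1
  set E := (Finset.range m).sup e
  set l := (a + b) * (E + 1)
  set n := W * l + 1 + E
  have hchain (i : ℕ) (hi : i ≤ m) :
      Module.finrank k ((J i).restrictScalars k ⊓ weightLT k x y W n : Submodule k A) + i * (l + 1) ≤
        Module.finrank k (weightLT k x y W n) := by
    have := finiteDimensional_weightLT (k := k) (x := x) (y := y) hW n
    induction i with
    | zero => simpa using Submodule.finrank_mono inf_le_right
    | succ i ih =>
      have h₁ := finrank_inf_add_lt hxy hW (hJ i).le (hz i) (hz' i) (he i) (n := n) (l := l)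
        (by
          have : e i ≤ E := Finset.le_sup (Finset.mem_range.mpr hi)
          omega)
      have h₂ := ih (by omega)
      rw [Nat.succ_mul]
      omega
  have h₁ := hchain m le_rfl
  have h₂ := finrank_weightLT_le hxy hW (hIJ m hPI) hr hP n
  have h₃ : m * (l + 1) ≤ (a + b) * n := by omega
  have h₄ : (a + b) * n = (a + b) * W * l + l := by
    simp only [n, l]
    ring
  rw [h₄, Nat.succ_mul, Nat.mul_succ] at h₃
  omega

end Weyl

/-- If `x` and `y` satisfy the Weyl relation, the monomials `x ^ i * y ^ j` span the algebra they
generate. -/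
theorem exists_eq_sum_monomials {k : Type u} {A : Type v} [Field k] [Ring A] [Algebra k A] {x y : A}
    (hxy : y * x = x * y + 1) (hgen : Algebra.adjoin k {x, y} = ⊤) (g : A) :
    ∃ c : (ℕ × ℕ) →₀ k, g = c.sum fun p r => r • (x ^ p.1 * y ^ p.2) := by
  set S : Submodule k A := Submodule.span k (Set.range fun p : ℕ × ℕ => x ^ p.1 * y ^ p.2)
  have hle (n : ℕ) : weightLT k x y 1 n ≤ S := Submodule.span_mono (Set.image_subset_range _ _)
  have hxS (h : A) (hh : h ∈ S) : x * h ∈ S := by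
    have : S ≤ S.comap (LinearMap.mulLeft k x) := by
      refine Submodule.span_le.mpr ?_
      rintro _ ⟨p, rfl⟩
      exact hle _ (x_mul_mem_weightLT (monomial_mem_weightLT (Nat.lt_succ_self _)))
    exact this hh
  have hyS (h : A) (hh : h ∈ S) : y * h ∈ S := by
    have : S ≤ S.comap (LinearMap.mulLeft k y) := by
      refine Submodule.span_le.mpr ?_
      rintro _ ⟨p, rfl⟩
      exact hle _ (y_mul_mem_weightLT hxy one_pos (monomial_mem_weightLT (Nat.lt_succ_self _)))
    exact this hh
  -- The span is stable under left multiplication by the generators, hence by all of `A`; it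
  -- contains `1`, so it is everything.
  have hmul (g : A) : ∀ h ∈ S, g * h ∈ S := by
    have hg : g ∈ Algebra.adjoin k {x, y} := hgen ▸ Algebra.mem_top
    induction hg using Algebra.adjoin_induction with
    | mem g hg =>
      rcases hg with rfl | rfl
      · exact hxS
      · exact hyS
    | algebraMap r => exact fun h hh => by rw [← Algebra.smul_def]; exact S.smul_mem r hh
    | add g₁ g₂ _ _ h₁ h₂ => exact fun h hh => by rw [add_mul]; exact add_mem (h₁ h hh) (h₂ h hh)
    | mul g₁ g₂ _ _ h₁ h₂ => exact fun h hh => by rw [mul_assoc]; exact h₁ _ (h₂ h hh)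
  have hg : g ∈ S := by
    simpa using hmul g 1 (Submodule.subset_span ⟨(0, 0), by simp⟩)
  obtain ⟨c, hc⟩ := Finsupp.mem_span_range_iff_exists_finsupp.mp hg
  exact ⟨c, hc.symm⟩

theorem WeylAlgebra.leftKrullDimLE_one (k : Type u) [Field k] [CharZero k] :
    LeftKrullDimLE (WeylAlgebra k) 1 := by
  let π := RingQuot.mkAlgHom k (WeylRel k)
  have hxy : π (FreeAlgebra.ι k 1) * π (FreeAlgebra.ι k 0) =
      π (FreeAlgebra.ι k 0) * π (FreeAlgebra.ι k 1) + 1 := by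
    simpa using RingQuot.mkAlgHom_rel k (WeylRel.comm (k := k))
  have hgen : Algebra.adjoin k {π (FreeAlgebra.ι k 0), π (FreeAlgebra.ι k 1)} = ⊤ := by
    have h := congrArg (Subalgebra.map π) (FreeAlgebra.adjoin_range_ι k (Fin 2))
    rw [AlgHom.map_adjoin, Algebra.map_top, ← Set.range_comp,
      (AlgHom.range_eq_top π).mpr (RingQuot.mkAlgHom_surjective k _)] at h
    rw [← h]
    congr 1
    ext g
    simp [Fin.exists_fin_two, eq_comm]
  exact leftKrullDimLE_one_of_isArtinian_quotient _ fun I hI =>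
    isArtinian_quotient_of_weyl hxy (exists_eq_sum_monomials hxy hgen) hI

end StarPrime

theorem mainTheorem4 :
    (∀ (R : Type u) [Ring R], StarPrime.LeftKrullDimLE R 1 →
      ∀ (M : Type v) [AddCommGroup M] [Module R M] [Nontrivial M],
        StarPrime.IsStarPrime R M → StarPrime.IsPrimeRing (Module.End R M)) ∧
    (∀ (k : Type u) [Field k] [CharZero k]
      (M : Type v) [AddCommGroup M] [Module (StarPrime.WeylAlgebra k) M] [Nontrivial M],
        StarPrime.IsStarPrime (StarPrime.WeylAlgebra k) M →
          StarPrime.IsPrimeRing (Module.End (StarPrime.WeylAlgebra k) M)) :=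
  ⟨fun _ _ hR _ _ _ _ hM => hM.isPrimeRing_end hR,
    fun k _ _ _ _ _ _ hM => hM.isPrimeRing_end (StarPrime.WeylAlgebra.leftKrullDimLE_one k)⟩
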